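/- Let $\mathscr{E}$ be the ring of germs at the origin of smooth ($C^\infty$) functions $f(x,\lambda)$ from $\mathbb{R}^2$ to $\mathbb{R}$, and let $K=\mathbb{R}$. A monomial germ is a germ $x^i\lambda^j$ with $i,j\ge 0$. Let $\prec$ be a local order on the monomials, i.e. a strict total order such that $x^{i}\lambda^{j}\prec x^{i'}\lambda^{j'}$ implies $x^{i+p}\lambda^{j+q}\prec x^{i'+p}\lambda^{j'+q}$ for all $p,q\ge 0$, and such that $x\prec 1$ and $\lambda\prec 1$. For $f\in\mathscr{E}$ whose Taylor series at the origin $\sum a_{ij}x^i\lambda^j$ is non-zero, the leading term $LT(f)$ is the non-zero term $a_{ij}x^i\lambda^j$ of this series with the greatest monomial with respect to $\prec$; if the Taylor series is zero, $LT(f):=0$. For an ideal $I$ of $\mathscr{E}$, let $LT(I)_{\mathscr{E}}$ be the ideal of $\mathscr{E}$ generated by all $LT(f)$, $f\in I$. A standard basis of $I$ is a finite set $S\subseteq I$ that generates $I$ and satisfies $LT(I)_{\mathscr{E}}=\langle LT(g) : g\in S\rangle_{\mathscr{E}}$. The ideal $I$ has finite codimension if $\langle x,\lambda\rangle_{\mathscr{E}}^{\,k}\subseteq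 I$ for some $k\in\mathbb{N}$. Let $I$ be an ideal of finite codimension in $\mathscr{E}$, let $S$ be a standard basis of $I$ with respect to a local order $\prec$, and let $$B=\{\,w : w \text{ is a monomial germ},\ w\notin\langle LT(g) : g\in S\rangle_{\mathscr{E}}\,\}.$$ Then the classes $w+I$, $w\in B$ (indexed by $w\in B$), form a $K$-vector-space basis of $\mathscr{E}/I$. -/

import Mathlib

open Filter Topology
open scoped ContDiff Nat

noncomputable section

namespace SmoothGerms

/-- A function is smooth near the origin of the `(x, l)`-plane: it is `C^∞` on a whole neighbourhood
of the origin. (`ContDiffAt ℝ ∞ f 0` alone would allow the neighbourhood to shrink with the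
order of differentiation.) -/
def SmoothNear (f : ℝ × ℝ → ℝ) : Prop :=
  ∀ᶠ p in 𝓝 (0 : ℝ × ℝ), ContDiffAt ℝ ∞ f p

/-- The subring of germs at the origin that have a representative which is smooth near the
origin. -/
def germRing : Subring (Germ (𝓝 (0 : ℝ × ℝ)) ℝ) where
  carrier := {F | ∃ f : ℝ × ℝ → ℝ, SmoothNear f ∧ F = (f : Germ (𝓝 (0 : ℝ × ℝ)) ℝ)}
  mul_mem' := by
    rintro _ _ ⟨f, hf, rfl⟩ ⟨g, hg, rfl⟩
    refine ⟨f * g, ?_, rfl⟩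
    filter_upwards [hf, hg] with p h1 h2 using h1.mul h2
  one_mem' := ⟨1, Eventually.of_forall fun _ => contDiffAt_const, rfl⟩
  add_mem' := by
    rintro _ _ ⟨f, hf, rfl⟩ ⟨g, hg, rfl⟩
    refine ⟨f + g, ?_, rfl⟩
    filter_upwards [hf, hg] with p h1 h2 using h1.add h2
  zero_mem' := ⟨0, Eventually.of_forall fun _ => contDiffAt_const, rfl⟩
  neg_mem' := by
    rintro _ ⟨f, hf, rfl⟩
    refine ⟨-f, ?_, rfl⟩
    filter_upwards [hf] with p h1 using h1.neg

/-- The ring `𝓔` of germs at the origin of smooth real functions of `(x, l)`. -/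
abbrev E : Type := germRing

/-- The germ of a function that is smooth near the origin. -/
def toGerm (f : ℝ × ℝ → ℝ) (hf : SmoothNear f) : E := ⟨(f : Germ (𝓝 (0 : ℝ × ℝ)) ℝ), f, hf, rfl⟩

/-- The inclusion of the constants. -/
def constHom : ℝ →+* E where
  toFun c := toGerm (fun _ => c) (Eventually.of_forall fun _ => contDiffAt_const)
  map_one' := rfl
  map_mul' _ _ := rfl
  map_zero' := rfl
  map_add' _ _ := rfl

/-- `𝓔` as a real algebra (through the constants); in particular `𝓔` and all its quotients by
ideals are real vector spaces. -/
instance : Algebra ℝ E := constHom.toAlgebra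

/-- The germ of the coordinate function `x`. -/
def X : E := toGerm Prod.fst (Eventually.of_forall fun _ => contDiffAt_fst)

/-- The germ of the coordinate function `l` (the distinguished parameter). -/
def L : E := toGerm Prod.snd (Eventually.of_forall fun _ => contDiffAt_snd)

/-- The monomial germ `x ^ i * l ^ j` with exponent `(i, j)`. -/
def monom (a : ℕ × ℕ) : E := X ^ a.1 * L ^ a.2

/-- The partial derivative with respect to `x`. -/
def partialX (f : ℝ × ℝ → ℝ) : ℝ × ℝ → ℝ := fun p => fderiv ℝ f p (1, 0)

/-- The partial derivative with respect to `l`. -/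
def partialL (f : ℝ × ℝ → ℝ) : ℝ × ℝ → ℝ := fun p => fderiv ℝ f p (0, 1)

/-- The coefficient of `x ^ i * l ^ j` in the Taylor series of a function at the origin:
`(∂_x^i ∂_l^j f)(0, 0) / (i! j!)`. -/
def taylorCoeff (f : ℝ × ℝ → ℝ) (a : ℕ × ℕ) : ℝ :=
  (partialX^[a.1] (partialL^[a.2] f)) 0 / ((a.1)! * (a.2)!)

theorem partialX_congr {f g : ℝ × ℝ → ℝ} (h : f =ᶠ[𝓝 0] g) : partialX f =ᶠ[𝓝 0] partialX g := by
  filter_upwards [h.fderiv (𝕜 := ℝ)] with p hp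
  simp only [partialX, hp]

theorem partialL_congr {f g : ℝ × ℝ → ℝ} (h : f =ᶠ[𝓝 0] g) : partialL f =ᶠ[𝓝 0] partialL g := by
  filter_upwards [h.fderiv (𝕜 := ℝ)] with p hp
  simp only [partialL, hp]

theorem taylorCoeff_congr {f g : ℝ × ℝ → ℝ} (h : f =ᶠ[𝓝 0] g) : taylorCoeff f = taylorCoeff g := by
  have h1 : ∀ n, ∀ u v : ℝ × ℝ → ℝ, u =ᶠ[𝓝 0] v → partialX^[n] u =ᶠ[𝓝 0] partialX^[n] v := by
    intro n
    induction n with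
    | zero => exact fun _ _ h => h
    | succ n ih => exact fun u v h => ih _ _ (partialX_congr h)
  have h2 : ∀ n, ∀ u v : ℝ × ℝ → ℝ, u =ᶠ[𝓝 0] v → partialL^[n] u =ᶠ[𝓝 0] partialL^[n] v := by
    intro n
    induction n with
    | zero => exact fun _ _ h => h
    | succ n ih => exact fun u v h => ih _ _ (partialL_congr h)
  funext a
  simp only [taylorCoeff, (h1 a.1 _ _ (h2 a.2 _ _ h)).eq_of_nhds]

/-- The Taylor coefficients of a germ at the origin (those of any representative). -/
def coeff (F : E) : ℕ × ℕ → ℝ :=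
  Germ.liftOn (F : Germ (𝓝 (0 : ℝ × ℝ)) ℝ) taylorCoeff fun _ _ h => taylorCoeff_congr h

/-- A local order on the monomials `x ^ i * l ^ j`, given as the strict order `a ≺ b` of their
exponents `a, b : ℕ × ℕ`: a strict total order that is compatible with multiplication and in which
`x ≺ 1` and `l ≺ 1`. -/
structure IsLocalOrder (r : ℕ × ℕ → ℕ × ℕ → Prop) : Prop where
  strictTotal : IsStrictTotalOrder (ℕ × ℕ) r
  add_right : ∀ a b c : ℕ × ℕ, r a b → r (a + c) (b + c)
  x_lt_one : r (1, 0) (0, 0)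
  l_lt_one : r (0, 1) (0, 0)

/-- `a` is the exponent of the greatest term of the Taylor series of `F`. -/
def IsLeadingExponent (r : ℕ × ℕ → ℕ × ℕ → Prop) (F : E) (a : ℕ × ℕ) : Prop :=
  coeff F a ≠ 0 ∧ ∀ b, coeff F b ≠ 0 → b ≠ a → r b a

open Classical in
/-- The leading term `LT(F)` with respect to `r`: the greatest term of the Taylor series of `F`,
and `0` if `F` is flat. (For a local order, every non-flat germ has a greatest term.) -/
def leadingTerm (r : ℕ × ℕ → ℕ × ℕ → Prop) (F : E) : E :=
  if h : ∃ a, IsLeadingExponent r F a then coeff F h.choose • monom h.choose else 0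

/-- The leading term ideal `LT(I)` of an ideal. -/
def leadingTermIdeal (r : ℕ × ℕ → ℕ × ℕ → Prop) (I : Ideal E) : Ideal E :=
  Ideal.span (leadingTerm r '' (I : Set E))

/-- `S` is a standard basis of `I`: a finite generating set whose leading terms generate the leading
term ideal of `I`. -/
structure IsStandardBasis (r : ℕ × ℕ → ℕ × ℕ → Prop) (S : Set E) (I : Ideal E) : Prop where
  finite : S.Finite
  span_eq : Ideal.span S = I
  leadingTermIdeal_eq : leadingTermIdeal r I = Ideal.span (leadingTerm r '' S)

/-- `I` has finite codimension: it contains a power of the ideal `⟨x, l⟩`. -/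
def FiniteCodim (I : Ideal E) : Prop :=
  ∃ k : ℕ, Ideal.span {X, L} ^ k ≤ I

/-- The set `B` of the monomial germs that do not lie in the ideal generated by the leading terms of
the elements of `S`. -/
def standardMonomials (r : ℕ × ℕ → ℕ × ℕ → Prop) (S : Set E) : Set E :=
  {w | (∃ a, w = monom a) ∧ w ∉ Ideal.span (leadingTerm r '' S)}

end SmoothGerms

end

/-! Independence: a vanishing combination of the classes gives a polynomial F in I whose exponents
all belong to B. If F were non-zero, its greatest monomial would lie in LT(I), hence in the ideal
generated by the leading terms of S, which B excludes (`linearIndependent_mk_standardMonomials`).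

Spanning: modulo I a germ equals its Taylor polynomial of degree < k, because the remainder lies in
⟨x, l⟩^k ⊆ I (`sub_sum_coeff_smul_monom_mem`, which rests on Hadamard's lemma). A monomial of degree
< k outside B is divisible by the leading monomial of some G ∈ S (`exists_isLeadingExponent_le`).
The corresponding monomial multiple of G lies in I, so the monomial is congruent to a combination of
strictly smaller ones, again of degree < k after truncation. Only finitely many monomials have
degree < k, so this reduction stops (`mk_monom_mem_span_standardMonomials`). -/

noncomputable section

namespace SmoothGerms

/-! ### Hadamard's lemma and globally smooth representatives -/

/-- Differentiation under the integral sign: the integral of a `C^n` family over a compact interval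
depends in a `C^n` way on the parameter. -/
theorem contDiff_intervalIntegral_param {P F : Type} [NormedAddCommGroup P] [NormedSpace ℝ P]
    [ProperSpace P] [NormedAddCommGroup F] [NormedSpace ℝ F] (a b : ℝ) (n : ℕ) (h : P × ℝ → F)
    (hh : ContDiff ℝ n h) : ContDiff ℝ n fun p => ∫ t in a..b, h (p, t) := by
  -- The derivative takes values in a space of linear maps into F, so the induction must range over
  -- all targets.
  induction n generalizing F with
  | zero =>
    rw [Nat.cast_zero, contDiff_zero] at hh ⊢
    exact intervalIntegral.continuous_parametric_intervalIntegral_of_continuous'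
      (f := fun p t => h (p, t)) hh a b
  | succ n ih =>
    have hd : Differentiable ℝ h := hh.differentiable (by simp)
    have hc : ContDiff ℝ n (fderiv ℝ h) := hh.fderiv_right (by simp)
    have hg : ContDiff ℝ n fun q : P × ℝ =>
        (fderiv ℝ h q).comp (ContinuousLinearMap.inl ℝ P ℝ) := hc.clm_comp contDiff_const
    have key (p : P) : HasFDerivAt (fun p => ∫ t in a..b, h (p, t))
        (∫ t in a..b, (fderiv ℝ h (p, t)).comp (ContinuousLinearMap.inl ℝ P ℝ)) p := by
      obtain ⟨C, hC⟩ := ((isCompact_closedBall p 1).prod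
        (isCompact_uIcc (a := a) (b := b))).exists_bound_of_continuousOn hg.continuous.continuousOn
      refine intervalIntegral.hasFDerivAt_integral_of_dominated_of_fderiv_le
        (F' := fun p t => (fderiv ℝ h (p, t)).comp (ContinuousLinearMap.inl ℝ P ℝ))
        (bound := fun _ => C) (Metric.closedBall_mem_nhds p one_pos) ?_ ?_ ?_ ?_ ?_ ?_
      · refine Eventually.of_forall fun q => Continuous.aestronglyMeasurable ?_
        exact hh.continuous.comp (by fun_prop)
      · exact (hh.continuous.comp (by fun_prop : Continuous fun t : ℝ => (p, t))).intervalIntegrable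
          _ _
      · exact (hg.continuous.comp (by fun_prop : Continuous fun t : ℝ =>
          (p, t))).aestronglyMeasurable
      · exact Eventually.of_forall fun t ht q hq => hC (q, t) ⟨hq, Set.uIoc_subset_uIcc ht⟩
      · exact intervalIntegrable_const
      · exact Eventually.of_forall fun t _ q _ =>
          (hd (q, t)).hasFDerivAt.comp q (hasFDerivAt_prodMk_left q t)
    rw [Nat.cast_succ, contDiff_succ_iff_fderiv]
    refine ⟨fun p => (key p).differentiableAt, by simp, ?_⟩
    rw [funext fun p => (key p).fderiv]
    exact ih _ hg

/-- Hadamard's lemma in the plane. -/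
theorem exists_eq_add_fst_mul_add_snd_mul {f : ℝ × ℝ → ℝ} (hf : ContDiff ℝ ∞ f) :
    ∃ g h : ℝ × ℝ → ℝ, ContDiff ℝ ∞ g ∧ ContDiff ℝ ∞ h ∧
      ∀ p, f p = f 0 + p.1 * g p + p.2 * h p := by
  have hf' : ContDiff ℝ ∞ (fderiv ℝ f) := hf.fderiv_right (by simp)
  have smooth (v : ℝ × ℝ) : ContDiff ℝ ∞ fun p => ∫ t in (0 : ℝ)..1, fderiv ℝ f (t • p) v := by
    rw [contDiff_infty]
    intro n
    refine contDiff_intervalIntegral_param 0 1 n (fun q => fderiv ℝ f (q.2 • q.1) v) ?_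
    exact ContDiff.of_le ((hf'.comp (contDiff_snd.smul contDiff_fst)).clm_apply contDiff_const)
      (by exact_mod_cast le_top)
  refine ⟨_, _, smooth (1, 0), smooth (0, 1), fun p => ?_⟩
  have int (v : ℝ × ℝ) : IntervalIntegrable (fun t : ℝ => fderiv ℝ f (t • p) v)
      MeasureTheory.volume 0 1 :=
    Continuous.intervalIntegrable ((hf'.continuous.comp (by fun_prop)).clm_apply
      continuous_const) _ _
  have ftc : ∫ t in (0 : ℝ)..1, fderiv ℝ f (t • p) p = f p - f 0 := by
    have := intervalIntegral.integral_eq_sub_of_hasDerivAt (f := fun t : ℝ => f (t • p))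
      (f' := fun t => fderiv ℝ f (t • p) p) (a := 0) (b := 1) (fun t _ => ?_) (int p)
    · simpa using this
    · have h1 : HasDerivAt (fun t : ℝ => t • p) p t := by
        simpa using (hasDerivAt_id t).smul_const p
      exact ((hf.differentiable (by simp)) (t • p)).hasFDerivAt.comp_hasDerivAt t h1
  have split : ∀ t : ℝ, fderiv ℝ f (t • p) p =
      p.1 * fderiv ℝ f (t • p) (1, 0) + p.2 * fderiv ℝ f (t • p) (0, 1) := by
    intro t
    have hp : p = p.1 • ((1, 0) : ℝ × ℝ) + p.2 • ((0, 1) : ℝ × ℝ) := by ext <;> simp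
    conv_lhs => rw [hp, map_add, map_smul, map_smul, ← hp]
    rfl
  simp_rw [split] at ftc
  rw [intervalIntegral.integral_add ((int _).const_mul _) ((int _).const_mul _),
    intervalIntegral.integral_const_mul, intervalIntegral.integral_const_mul] at ftc
  linarith

/-- A function that is smooth near the origin agrees near the origin with a smooth function. -/
theorem SmoothNear.exists_contDiff_eventuallyEq {f : ℝ × ℝ → ℝ} (hf : SmoothNear f) :
    ∃ g : ℝ × ℝ → ℝ, ContDiff ℝ ∞ g ∧ g =ᶠ[𝓝 0] f := by
  obtain ⟨ε, hε, hsub⟩ := Metric.mem_nhds_iff.1 hf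
  -- The bump vanishes outside radius ε / 2, so the product is smooth even where f is not.
  let χ : ContDiffBump (0 : ℝ × ℝ) := ⟨ε / 4, ε / 2, by positivity, by linarith⟩
  refine ⟨fun p => χ p * f p, contDiff_iff_contDiffAt.2 fun p => ?_, ?_⟩
  · by_cases hp : p ∈ Metric.ball (0 : ℝ × ℝ) ε
    · exact χ.contDiffAt.mul (hsub hp)
    · have hz : (fun p => χ p * f p) =ᶠ[𝓝 p] fun _ => 0 := by
        have hp' : p ∈ (Metric.closedBall (0 : ℝ × ℝ) (ε / 2))ᶜ := fun h =>
          hp (Metric.closedBall_subset_ball (by linarith) h)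
        filter_upwards [Metric.isClosed_closedBall.isOpen_compl.mem_nhds hp'] with q hq
        rw [χ.zero_of_le_dist (le_of_lt (by simpa using hq)), zero_mul]
      exact contDiffAt_const.congr_of_eventuallyEq hz
  · filter_upwards [χ.eventuallyEq_one] with p hp
    simp [hp]

/-! ### Directional derivatives as derivations of the ring of germs -/

theorem toGerm_eq_iff {f g : ℝ × ℝ → ℝ} {hf : SmoothNear f} {hg : SmoothNear g} :
    toGerm f hf = toGerm g hg ↔ f =ᶠ[𝓝 0] g :=
  Subtype.ext_iff.trans Germ.coe_eq

theorem exists_toGerm_eq (F : E) : ∃ f, ∃ hf : SmoothNear f, toGerm f hf = F := by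
  obtain ⟨F, f, hf, rfl⟩ := F
  exact ⟨f, hf, rfl⟩

theorem smul_eq_constHom_mul (c : ℝ) (F : E) : c • F = constHom c * F := rfl

theorem SmoothNear.fderiv_apply {f : ℝ × ℝ → ℝ} (hf : SmoothNear f) (v : ℝ × ℝ) :
    SmoothNear fun p => fderiv ℝ f p v := by
  filter_upwards [hf] with p hp
  exact (hp.fderiv_right (by simp)).clm_apply contDiffAt_const

theorem SmoothNear.eventually_differentiableAt {f : ℝ × ℝ → ℝ} (hf : SmoothNear f) :
    ∀ᶠ p in 𝓝 0, DifferentiableAt ℝ f p := by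
  filter_upwards [hf] with p hp using hp.differentiableAt (by simp)

/-- The derivative of a germ in the direction `v`, as a function. -/
def dirDerivFun (v : ℝ × ℝ) (F : E) : E :=
  toGerm (fun p => fderiv ℝ (exists_toGerm_eq F).choose p v)
    ((exists_toGerm_eq F).choose_spec.choose.fderiv_apply v)

theorem dirDerivFun_toGerm (v : ℝ × ℝ) (f : ℝ × ℝ → ℝ) (hf : SmoothNear f) :
    dirDerivFun v (toGerm f hf) = toGerm (fun p => fderiv ℝ f p v) (hf.fderiv_apply v) := by
  refine toGerm_eq_iff.2 ?_
  have h := toGerm_eq_iff.1 (exists_toGerm_eq (toGerm f hf)).choose_spec.choose_spec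
  filter_upwards [h.fderiv (𝕜 := ℝ)] with p hp
  rw [hp]

theorem dirDerivFun_add (v : ℝ × ℝ) (F G : E) :
    dirDerivFun v (F + G) = dirDerivFun v F + dirDerivFun v G := by
  obtain ⟨f, hf, rfl⟩ := exists_toGerm_eq F
  obtain ⟨g, hg, rfl⟩ := exists_toGerm_eq G
  have h : SmoothNear (f + g) := by filter_upwards [hf, hg] with p h1 h2 using h1.add h2
  have h0 : toGerm f hf + toGerm g hg = toGerm (f + g) h := rfl
  rw [h0, dirDerivFun_toGerm, dirDerivFun_toGerm, dirDerivFun_toGerm]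
  refine Subtype.ext (Germ.coe_eq.2 ?_)
  filter_upwards [hf.eventually_differentiableAt, hg.eventually_differentiableAt] with p h1 h2
  simp [fderiv_add h1 h2]

theorem dirDerivFun_mul (v : ℝ × ℝ) (F G : E) :
    dirDerivFun v (F * G) = F * dirDerivFun v G + G * dirDerivFun v F := by
  obtain ⟨f, hf, rfl⟩ := exists_toGerm_eq F
  obtain ⟨g, hg, rfl⟩ := exists_toGerm_eq G
  have h : SmoothNear (f * g) := by filter_upwards [hf, hg] with p h1 h2 using h1.mul h2
  have h0 : toGerm f hf * toGerm g hg = toGerm (f * g) h := rfl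
  rw [h0, dirDerivFun_toGerm, dirDerivFun_toGerm, dirDerivFun_toGerm]
  refine Subtype.ext (Germ.coe_eq.2 ?_)
  filter_upwards [hf.eventually_differentiableAt, hg.eventually_differentiableAt] with p h1 h2
  simp [fderiv_mul h1 h2]

theorem dirDerivFun_constHom (v : ℝ × ℝ) (c : ℝ) : dirDerivFun v (constHom c) = 0 := by
  have hc : SmoothNear fun _ => c := Eventually.of_forall fun _ => contDiffAt_const
  refine (dirDerivFun_toGerm v _ hc).trans ?_
  refine Subtype.ext (Germ.coe_eq.2 (Eventually.of_forall fun p => ?_))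
  simp

/-- The derivative of germs in the direction `v`. -/
def dirDeriv (v : ℝ × ℝ) : Derivation ℝ E E :=
  Derivation.mk'
    { toFun := dirDerivFun v
      map_add' := dirDerivFun_add v
      map_smul' := fun c F => by
        simp [smul_eq_constHom_mul, dirDerivFun_mul, dirDerivFun_constHom] }
    (dirDerivFun_mul v)

theorem dirDeriv_toGerm (v : ℝ × ℝ) (f : ℝ × ℝ → ℝ) (hf : SmoothNear f) :
    dirDeriv v (toGerm f hf) = toGerm (fun p => fderiv ℝ f p v) (hf.fderiv_apply v) :=
  dirDerivFun_toGerm v f hf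

theorem dirDeriv_X (v : ℝ × ℝ) : dirDeriv v X = algebraMap ℝ E v.1 := by
  refine (dirDeriv_toGerm v Prod.fst (Eventually.of_forall fun _ => contDiffAt_fst)).trans ?_
  refine Subtype.ext (Germ.coe_eq.2 (Eventually.of_forall fun p => ?_))
  simp [fderiv_fst]

theorem dirDeriv_L (v : ℝ × ℝ) : dirDeriv v L = algebraMap ℝ E v.2 := by
  refine (dirDeriv_toGerm v Prod.snd (Eventually.of_forall fun _ => contDiffAt_snd)).trans ?_
  refine Subtype.ext (Germ.coe_eq.2 (Eventually.of_forall fun p => ?_))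
  simp [fderiv_snd]

/-- The value of a germ at the origin. -/
def evalZero : E →ₐ[ℝ] ℝ :=
  { Germ.valueRingHom.comp germRing.subtype with
    commutes' := fun _ => rfl }

theorem evalZero_toGerm (f : ℝ × ℝ → ℝ) (hf : SmoothNear f) : evalZero (toGerm f hf) = f 0 := rfl

@[simp] theorem evalZero_X : evalZero X = 0 := rfl

@[simp] theorem evalZero_L : evalZero L = 0 := rfl

theorem SmoothNear.iterate_fderiv_apply {f : ℝ × ℝ → ℝ} (hf : SmoothNear f) (v : ℝ × ℝ) (n : ℕ) :
    SmoothNear ((fun g p => fderiv ℝ g p v)^[n] f) := by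
  induction n generalizing f with
  | zero => exact hf
  | succ n ih => exact ih (hf.fderiv_apply v)

theorem dirDeriv_pow_toGerm (v : ℝ × ℝ) (n : ℕ) (f : ℝ × ℝ → ℝ) (hf : SmoothNear f) :
    ((dirDeriv v : E →ₗ[ℝ] E) ^ n) (toGerm f hf) =
      toGerm ((fun g p => fderiv ℝ g p v)^[n] f) (hf.iterate_fderiv_apply v n) := by
  induction n generalizing f with
  | zero => rfl
  | succ n ih =>
    rw [pow_succ, Module.End.mul_apply, Derivation.coeFn_coe, dirDeriv_toGerm, ih]
    rfl

/-! ### Taylor coefficients: linearity and shift under monomials -/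

/-- The Taylor coefficient of exponent `a`, as a linear form. -/
def coeffLinear (a : ℕ × ℕ) : E →ₗ[ℝ] ℝ :=
  ((a.1 ! : ℝ) * a.2 !)⁻¹ • evalZero.toLinearMap ∘ₗ ((dirDeriv (1, 0) : E →ₗ[ℝ] E) ^ a.1) ∘ₗ
    ((dirDeriv (0, 1) : E →ₗ[ℝ] E) ^ a.2)

theorem coeff_eq_coeffLinear (F : E) (a : ℕ × ℕ) : coeff F a = coeffLinear a F := by
  obtain ⟨f, hf, rfl⟩ := exists_toGerm_eq F
  simp only [coeffLinear, LinearMap.smul_apply, LinearMap.comp_apply, dirDeriv_pow_toGerm,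
    AlgHom.toLinearMap_apply, evalZero_toGerm, smul_eq_mul]
  rw [mul_comm, ← div_eq_mul_inv]
  rfl

theorem coeff_eq (F : E) (a : ℕ × ℕ) : coeff F a = ((a.1 ! : ℝ) * a.2 !)⁻¹ *
    evalZero (((dirDeriv (1, 0) : E →ₗ[ℝ] E) ^ a.1) (((dirDeriv (0, 1) : E →ₗ[ℝ] E) ^ a.2) F)) := by
  rw [coeff_eq_coeffLinear]
  rfl

theorem coeff_zero (a : ℕ × ℕ) : coeff 0 a = 0 := by
  rw [coeff_eq_coeffLinear, map_zero]

theorem coeff_add (F G : E) (a : ℕ × ℕ) : coeff (F + G) a = coeff F a + coeff G a := by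
  simp only [coeff_eq_coeffLinear, map_add]

theorem coeff_sub (F G : E) (a : ℕ × ℕ) : coeff (F - G) a = coeff F a - coeff G a := by
  simp only [coeff_eq_coeffLinear, map_sub]

theorem coeff_smul (c : ℝ) (F : E) (a : ℕ × ℕ) : coeff (c • F) a = c * coeff F a := by
  simp only [coeff_eq_coeffLinear, map_smul, smul_eq_mul]

theorem coeff_sum {ι : Type*} (s : Finset ι) (F : ι → E) (a : ℕ × ℕ) :
    coeff (∑ i ∈ s, F i) a = ∑ i ∈ s, coeff (F i) a := by
  simp only [coeff_eq_coeffLinear, map_sum]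

theorem derivation_pow_mul_of_eq_zero (D : Derivation ℝ E E) {Y : E} (hY : D Y = 0) (n : ℕ)
    (F : E) : ((D : E →ₗ[ℝ] E) ^ n) (Y * F) = Y * ((D : E →ₗ[ℝ] E) ^ n) F := by
  induction n generalizing F with
  | zero => rfl
  | succ n ih =>
    rw [pow_succ, Module.End.mul_apply, Module.End.mul_apply, ← ih]
    simp [hY]

/-- Leibniz's rule with all higher derivatives of Y zero. When Y is a coordinate, the first term
dies at the origin and the factor n + 1 cancels against (n + 1)!, so multiplication by Y becomes a
shift of Taylor coefficients. -/
theorem derivation_pow_succ_mul_of_eq_one (D : Derivation ℝ E E) {Y : E} (hY : D Y = 1) (n : ℕ)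
    (F : E) : ((D : E →ₗ[ℝ] E) ^ (n + 1)) (Y * F) =
      Y * ((D : E →ₗ[ℝ] E) ^ (n + 1)) F + (n + 1 : ℝ) • ((D : E →ₗ[ℝ] E) ^ n) F := by
  induction n generalizing F with
  | zero => simp [hY]
  | succ n ih =>
    have h : ((D : E →ₗ[ℝ] E) ^ (n + 1 + 1)) (Y * F) =
        ((D : E →ₗ[ℝ] E) ^ (n + 1)) (Y * D F) + ((D : E →ₗ[ℝ] E) ^ (n + 1)) F := by
      rw [pow_succ, Module.End.mul_apply, ← map_add]
      simp [hY]
    rw [h, ih, pow_succ _ (n + 1), Module.End.mul_apply, Derivation.coeFn_coe, pow_succ _ n,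
      Module.End.mul_apply, Module.End.mul_apply, Derivation.coeFn_coe]
    push_cast
    module

theorem coeff_X_mul_succ (F : E) (i j : ℕ) : coeff (X * F) (i + 1, j) = coeff F (i, j) := by
  rw [coeff_eq, coeff_eq, derivation_pow_mul_of_eq_zero _ (by simp [dirDeriv_X]),
    derivation_pow_succ_mul_of_eq_one _ (by simp [dirDeriv_X])]
  simp only [map_add, map_mul, evalZero_X, map_smul, Nat.factorial_succ, smul_eq_mul]
  push_cast
  have := Nat.factorial_ne_zero i
  have := Nat.factorial_ne_zero j
  field_simp
  ring

theorem coeff_X_mul_zero (F : E) (j : ℕ) : coeff (X * F) (0, j) = 0 := by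
  rw [coeff_eq, derivation_pow_mul_of_eq_zero _ (by simp [dirDeriv_X])]
  simp

theorem coeff_L_mul_succ (F : E) (i j : ℕ) : coeff (L * F) (i, j + 1) = coeff F (i, j) := by
  rw [coeff_eq, coeff_eq, derivation_pow_succ_mul_of_eq_one _ (by simp [dirDeriv_L]), map_add,
    derivation_pow_mul_of_eq_zero _ (by simp [dirDeriv_L])]
  simp only [map_add, map_mul, evalZero_L, map_smul, Nat.factorial_succ, smul_eq_mul]
  push_cast
  have := Nat.factorial_ne_zero i
  have := Nat.factorial_ne_zero j
  field_simp
  ring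

theorem coeff_L_mul_zero (F : E) (i : ℕ) : coeff (L * F) (i, 0) = 0 := by
  rw [coeff_eq, pow_zero, Module.End.one_apply,
    derivation_pow_mul_of_eq_zero _ (by simp [dirDeriv_L])]
  simp

theorem coeff_one (a : ℕ × ℕ) : coeff 1 a = if a = 0 then 1 else 0 := by
  have h (D : Derivation ℝ E E) (n : ℕ) : ((D : E →ₗ[ℝ] E) ^ (n + 1)) 1 = 0 := by
    rw [pow_succ, Module.End.mul_apply]
    simp
  obtain ⟨i, _ | j⟩ := a
  · obtain _ | i := i
    · simp [coeff_eq]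
    · simp [coeff_eq, h]
  · simp [coeff_eq, h]

theorem coeff_X_pow_mul (F : E) (n i j : ℕ) :
    coeff (X ^ n * F) (i, j) = if n ≤ i then coeff F (i - n, j) else 0 := by
  induction n generalizing i with
  | zero => simp
  | succ n ih =>
    rw [pow_succ', mul_assoc]
    obtain _ | i := i
    · simp [coeff_X_mul_zero]
    · simp [coeff_X_mul_succ, ih]

theorem coeff_L_pow_mul (F : E) (n i j : ℕ) :
    coeff (L ^ n * F) (i, j) = if n ≤ j then coeff F (i, j - n) else 0 := by
  induction n generalizing j with
  | zero => simp
  | succ n ih =>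
    rw [pow_succ', mul_assoc]
    obtain _ | j := j
    · simp [coeff_L_mul_zero]
    · simp [coeff_L_mul_succ, ih]

theorem coeff_monom_mul (c : ℕ × ℕ) (F : E) (a : ℕ × ℕ) :
    coeff (monom c * F) a = if c ≤ a then coeff F (a - c) else 0 := by
  obtain ⟨i, j⟩ := a
  obtain ⟨p, q⟩ := c
  rw [monom, mul_assoc, coeff_X_pow_mul, coeff_L_pow_mul, ← ite_and]
  rfl

theorem coeff_monom (c a : ℕ × ℕ) : coeff (monom c) a = if a = c then 1 else 0 := by
  have h := coeff_monom_mul c 1 a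
  rw [mul_one, coeff_one, ← ite_and] at h
  rw [h]
  refine if_congr ⟨fun ⟨h1, h2⟩ => ?_, fun h => by simp [h]⟩ rfl rfl
  rw [← tsub_add_cancel_of_le h1, h2, zero_add]

theorem monom_add (a b : ℕ × ℕ) : monom (a + b) = monom a * monom b := by
  simp only [monom, Prod.fst_add, Prod.snd_add]
  ring

/-! ### Powers of ⟨x, l⟩ and Taylor's formula -/

/-- The ideal of the germs that vanish at the origin. -/
abbrev maxIdeal : Ideal E := Ideal.span {X, L}

theorem coeff_eq_zero_of_mem_maxIdeal_pow {k : ℕ} {F : E} (hF : F ∈ maxIdeal ^ k) {a : ℕ × ℕ}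
    (ha : a.1 + a.2 < k) : coeff F a = 0 := by
  induction k generalizing F a with
  | zero => omega
  | succ k ih =>
    rw [pow_succ'] at hF
    induction hF using Submodule.mul_induction_on' with
    | add u _ v _ hu hv => rw [coeff_add, hu, hv, add_zero]
    | mem_mul_mem m hm n hn =>
      obtain ⟨u, v, rfl⟩ := Ideal.mem_span_pair.1 hm
      rw [show (u * X + v * L) * n = X * (u * n) + L * (v * n) by ring, coeff_add]
      have hu : u * n ∈ maxIdeal ^ k := Ideal.mul_mem_left _ _ hn
      have hv : v * n ∈ maxIdeal ^ k := Ideal.mul_mem_left _ _ hn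
      have h1 : coeff (X * (u * n)) a = 0 := by
        obtain ⟨_ | i, j⟩ := a
        · exact coeff_X_mul_zero _ _
        · rw [coeff_X_mul_succ]
          exact ih hu (by simp only at ha ⊢; omega)
      have h2 : coeff (L * (v * n)) a = 0 := by
        obtain ⟨i, _ | j⟩ := a
        · exact coeff_L_mul_zero _ _
        · rw [coeff_L_mul_succ]
          exact ih hv (by simp only at ha ⊢; omega)
      rw [h1, h2, add_zero]

theorem X_mem_maxIdeal : X ∈ maxIdeal := Ideal.subset_span (by simp)

theorem L_mem_maxIdeal : L ∈ maxIdeal := Ideal.subset_span (by simp)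

/-- Hadamard's lemma for germs. -/
theorem exists_eq_add_X_mul_add_L_mul (F : E) :
    ∃ (c : ℝ) (G H : E), F = c • 1 + X * G + L * H := by
  obtain ⟨f, hf, rfl⟩ := exists_toGerm_eq F
  obtain ⟨f', hf', hff⟩ := hf.exists_contDiff_eventuallyEq
  obtain ⟨g, h, hg, hh, heq⟩ := exists_eq_add_fst_mul_add_snd_mul hf'
  refine ⟨f' 0, toGerm g (Eventually.of_forall fun _ => hg.contDiffAt),
    toGerm h (Eventually.of_forall fun _ => hh.contDiffAt), Subtype.ext (Germ.coe_eq.2 ?_)⟩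
  filter_upwards [hff] with p hp
  rw [← hp, heq p]
  simp

/-- Hadamard's lemma iterated: approximating the two cofactors to order k approximates the germ to
order k + 1. -/
theorem exists_polynomial_sub_mem (k : ℕ) (F : E) :
    ∃ P ∈ Submodule.span ℝ (monom '' {a | a.1 + a.2 < k}), F - P ∈ maxIdeal ^ k := by
  induction k generalizing F with
  | zero => exact ⟨0, zero_mem _, by simp⟩
  | succ k ih =>
    obtain ⟨c, G, H, rfl⟩ := exists_eq_add_X_mul_add_L_mul F
    obtain ⟨P, hP, hGP⟩ := ih G
    obtain ⟨Q, hQ, hHQ⟩ := ih H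
    have mul_mem (e : ℕ × ℕ) (he : e.1 + e.2 = 1) {R : E}
        (hR : R ∈ Submodule.span ℝ (monom '' {a | a.1 + a.2 < k})) :
        monom e * R ∈ Submodule.span ℝ (monom '' {a | a.1 + a.2 < k + 1}) := by
      induction hR using Submodule.span_induction with
      | zero => simp
      | add u v _ _ hu hv => rw [mul_add]; exact add_mem hu hv
      | smul c u _ hu => rw [mul_smul_comm]; exact Submodule.smul_mem _ _ hu
      | mem u hu =>
        obtain ⟨a, ha, rfl⟩ := hu
        rw [← monom_add]
        refine Submodule.subset_span ⟨_, ?_, rfl⟩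
        simp only [Set.mem_ofPred_eq, Prod.fst_add, Prod.snd_add] at ha ⊢
        omega
    have hX : monom (1, 0) = X := by simp [monom]
    have hL : monom (0, 1) = L := by simp [monom]
    refine ⟨c • 1 + X * P + L * Q, ?_, ?_⟩
    · rw [← hX, ← hL]
      refine add_mem (add_mem (Submodule.smul_mem _ _ (Submodule.subset_span
        ⟨(0, 0), by simp, by simp [monom]⟩)) (mul_mem _ (by simp) hP)) (mul_mem _ (by simp) hQ)
    · rw [show c • 1 + X * G + L * H - (c • 1 + X * P + L * Q) = X * (G - P) + L * (H - Q) by ring,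
        pow_succ']
      exact add_mem (Ideal.mul_mem_mul X_mem_maxIdeal hGP) (Ideal.mul_mem_mul L_mem_maxIdeal hHQ)

theorem finite_setOf_add_lt (k : ℕ) : {a : ℕ × ℕ | a.1 + a.2 < k}.Finite := by
  refine ((Set.finite_Iio k).prod (Set.finite_Iio k)).subset fun a ha => ?_
  simp only [Set.mem_ofPred_eq, Set.mem_prod, Set.mem_Iio] at ha ⊢
  omega

/-- Taylor's formula for germs. -/
theorem sub_sum_coeff_smul_monom_mem (k : ℕ) (F : E) :
    F - ∑ a ∈ (finite_setOf_add_lt k).toFinset, coeff F a • monom a ∈ maxIdeal ^ k := by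
  obtain ⟨P, hP, hFP⟩ := exists_polynomial_sub_mem k F
  have hPsum : ∑ a ∈ (finite_setOf_add_lt k).toFinset, coeff P a • monom a = P := by
    clear hFP
    induction hP using Submodule.span_induction with
    | zero => simp [coeff_zero]
    | add u v _ _ hu hv => simp only [coeff_add, add_smul, Finset.sum_add_distrib, hu, hv]
    | smul c u _ hu => simp only [coeff_smul, mul_smul, ← Finset.smul_sum, hu]
    | mem u hu =>
      obtain ⟨b, hb, rfl⟩ := hu
      rw [Finset.sum_eq_single b] <;> simp_all [coeff_monom]
  -- F and P have the same coefficients in degree < k because F - P lies in the k-th power.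
  have hsum : ∑ a ∈ (finite_setOf_add_lt k).toFinset, coeff F a • monom a = P := by
    rw [← hPsum]
    refine Finset.sum_congr rfl fun a ha => ?_
    have := coeff_eq_zero_of_mem_maxIdeal_pow hFP (by simpa using ha)
    rw [coeff_sub] at this
    rw [sub_eq_zero.1 this]
  rwa [hsum]

/-! ### Leading exponents and leading term ideals -/

variable {r : ℕ × ℕ → ℕ × ℕ → Prop}

theorem IsLocalOrder.asymm (hr : IsLocalOrder r) {a b : ℕ × ℕ} (h : r a b) : ¬ r b a :=
  have := hr.strictTotal
  asymm_of r h

theorem IsLeadingExponent.unique (hr : IsLocalOrder r) {F : E} {a b : ℕ × ℕ}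
    (ha : IsLeadingExponent r F a) (hb : IsLeadingExponent r F b) : a = b := by
  by_contra hab
  exact hr.asymm (ha.2 b hb.1 (Ne.symm hab)) (hb.2 a ha.1 hab)

theorem IsLeadingExponent.leadingTerm_eq (hr : IsLocalOrder r) {F : E} {a : ℕ × ℕ}
    (ha : IsLeadingExponent r F a) : leadingTerm r F = coeff F a • monom a := by
  have h : ∃ a, IsLeadingExponent r F a := ⟨a, ha⟩
  rw [leadingTerm, dif_pos h, h.choose_spec.unique hr ha]

theorem leadingTerm_eq_zero {F : E} (h : ¬ ∃ a, IsLeadingExponent r F a) :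
    leadingTerm r F = 0 := dif_neg h

theorem IsLeadingExponent.monom_mul (hr : IsLocalOrder r) {F : E} {a : ℕ × ℕ}
    (ha : IsLeadingExponent r F a) (c : ℕ × ℕ) : IsLeadingExponent r (monom c * F) (c + a) := by
  refine ⟨?_, fun b hb hne => ?_⟩
  · rw [coeff_monom_mul, if_pos le_self_add, add_tsub_cancel_left]
    exact ha.1
  · rw [coeff_monom_mul] at hb
    split_ifs at hb with hcb
    · obtain ⟨d, rfl⟩ := exists_add_of_le hcb
      rw [add_tsub_cancel_left] at hb
      rw [add_comm c, add_comm c]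
      exact hr.add_right _ _ _ (ha.2 d hb fun h => hne (by rw [h]))
    · exact absurd rfl hb

/-- A germ with only finitely many non-zero Taylor coefficients, not all of them zero, has a leading
exponent. -/
theorem exists_isLeadingExponent (hr : IsLocalOrder r) {F : E}
    (hfin : {a | coeff F a ≠ 0}.Finite) (hne : ∃ a, coeff F a ≠ 0) :
    ∃ a, IsLeadingExponent r F a := by
  have := hr.strictTotal
  obtain ⟨a, ha⟩ := hne
  -- The order is reversed, so a minimal element is the greatest exponent.
  have hwf : WellFounded fun b c : {a | coeff F a ≠ 0} => r c b :=
    hfin.wellFoundedOn (r := Function.swap r)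
  obtain ⟨⟨m, hm⟩, -, hmax⟩ := hwf.has_min Set.univ ⟨⟨a, ha⟩, trivial⟩
  refine ⟨m, hm, fun b hb hne => ?_⟩
  rcases trichotomous_of r b m with h | h | h
  · exact h
  · exact absurd h hne
  · exact absurd h (hmax ⟨b, hb⟩ trivial)

theorem monom_mem_leadingTermIdeal (hr : IsLocalOrder r) {I : Ideal E} {F : E} (hF : F ∈ I)
    {a : ℕ × ℕ} (ha : IsLeadingExponent r F a) : monom a ∈ leadingTermIdeal r I := by
  have h : leadingTerm r F ∈ leadingTermIdeal r I := Ideal.subset_span ⟨F, hF, rfl⟩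
  rw [ha.leadingTerm_eq hr] at h
  have h2 := Ideal.mul_mem_left _ (constHom (coeff F a)⁻¹) h
  rwa [← smul_eq_constHom_mul, smul_smul, inv_mul_cancel₀ ha.1, one_smul] at h2

/-- A monomial in the ideal generated by the leading terms of a set is divisible by one of them. -/
theorem exists_isLeadingExponent_le (hr : IsLocalOrder r) {S : Set E} {a : ℕ × ℕ}
    (ha : monom a ∈ Ideal.span (leadingTerm r '' S)) :
    ∃ G ∈ S, ∃ e ≤ a, IsLeadingExponent r G e := by
  by_contra! hcon
  -- The multiplier H makes the claim stable under multiplication by arbitrary germs; a multiple of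
  -- a monomial has non-zero coefficients only at exponents which that monomial divides.
  have key : ∀ F ∈ Ideal.span (leadingTerm r '' S), ∀ H : E, coeff (H * F) a = 0 := by
    intro F hF
    induction hF using Submodule.span_induction with
    | zero => simp [coeff_zero]
    | add u v _ _ hu hv => intro H; rw [mul_add, coeff_add, hu, hv, add_zero]
    | smul c u _ hu => intro H; rw [smul_eq_mul, ← mul_assoc]; exact hu _
    | mem u hu =>
      intro H
      obtain ⟨G, hG, rfl⟩ := hu
      by_cases h : ∃ e, IsLeadingExponent r G e
      · obtain ⟨e, he⟩ := h
        have hle : ¬ e ≤ a := fun hle => hcon G hG e hle he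
        rw [he.leadingTerm_eq hr, mul_smul_comm, coeff_smul, mul_comm H, coeff_monom_mul,
          if_neg hle, mul_zero]
      · rw [leadingTerm_eq_zero h, mul_zero, coeff_zero]
  have := key _ ha 1
  simp [coeff_monom] at this

/-! ### Independence and spanning of the standard monomials -/

theorem linearIndependent_mk_standardMonomials (hr : IsLocalOrder r) {I : Ideal E} {S : Set E}
    (hS : IsStandardBasis r S I) :
    LinearIndependent ℝ fun w : standardMonomials r S => Ideal.Quotient.mk I (w : E) := by
  choose e he using fun w : standardMonomials r S => w.2.1
  have he_inj : Function.Injective e := fun v w h => Subtype.ext (by rw [he v, he w, h])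
  rw [linearIndependent_iff']
  intro s g hsum w₀ hw₀
  by_contra hg
  set F : E := ∑ w ∈ s, g w • (w : E) with hF
  have hFI : F ∈ I := by
    rw [← Ideal.Quotient.eq_zero_iff_mem, ← hsum, hF, map_sum]
    rfl
  have hcoeff (a : ℕ × ℕ) : coeff F a = ∑ w ∈ s, if a = e w then g w else 0 := by
    rw [hF, coeff_sum]
    refine Finset.sum_congr rfl fun w _ => ?_
    rw [coeff_smul, he w, coeff_monom, mul_ite, mul_one, mul_zero]
  have hsupp (a : ℕ × ℕ) (ha : coeff F a ≠ 0) : ∃ w ∈ s, e w = a := by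
    rw [hcoeff] at ha
    obtain ⟨w, hw, hne⟩ := Finset.exists_ne_zero_of_sum_ne_zero ha
    exact ⟨w, hw, by by_contra h; exact hne (if_neg (Ne.symm h))⟩
  obtain ⟨a, ha⟩ := exists_isLeadingExponent hr (F := F)
    ((s.finite_toSet.image e).subset fun a ha => hsupp a ha)
    ⟨e w₀, by
      rwa [hcoeff, Finset.sum_eq_single w₀ (fun w _ hne => if_neg fun h => hne (he_inj h).symm)
        (absurd hw₀), if_pos rfl]⟩
  obtain ⟨w, -, rfl⟩ := hsupp a ha.1
  refine w.2.2 ?_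
  rw [← hS.leadingTermIdeal_eq, he w]
  exact monom_mem_leadingTermIdeal hr hFI ha

theorem mk_mem_of_forall_mk_monom_mem {I : Ideal E} {k : ℕ} (hk : maxIdeal ^ k ≤ I)
    {V : Submodule ℝ (E ⧸ I)} {F : E} (h : ∀ a : ℕ × ℕ, a.1 + a.2 < k → coeff F a ≠ 0 →
      Ideal.Quotient.mk I (monom a) ∈ V) : Ideal.Quotient.mk I F ∈ V := by
  rw [Ideal.Quotient.eq.2 (hk (sub_sum_coeff_smul_monom_mem k F)), map_sum]
  refine Submodule.sum_mem _ fun a ha => ?_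
  by_cases h0 : coeff F a = 0
  · simp [h0]
  · exact V.smul_mem _ (h a (by simpa using ha) h0)

theorem mk_monom_mem_span_standardMonomials (hr : IsLocalOrder r) {I : Ideal E} {S : Set E}
    (hS : IsStandardBasis r S I) {k : ℕ} (hk : maxIdeal ^ k ≤ I) {a : ℕ × ℕ}
    (ha : a.1 + a.2 < k) : Ideal.Quotient.mk I (monom a) ∈ Submodule.span ℝ
      (Set.range fun w : standardMonomials r S => Ideal.Quotient.mk I (w : E)) := by
  have := hr.strictTotal
  -- A local order is not well-founded (the powers of x descend forever), but it is on the finite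
  -- set of exponents of degree < k.
  refine ((finite_setOf_add_lt k).wellFoundedOn (r := r)).induction
    (P := fun a => Ideal.Quotient.mk I (monom a) ∈ Submodule.span ℝ
      (Set.range fun w : standardMonomials r S => Ideal.Quotient.mk I (w : E)))
    ha fun a ha ih => ?_
  by_cases hB : monom a ∈ Ideal.span (leadingTerm r '' S)
  · obtain ⟨G, hG, e, hea, he⟩ := exists_isLeadingExponent_le hr hB
    have hlead := he.monom_mul hr (a - e)
    rw [tsub_add_cancel_of_le hea] at hlead
    set F := monom (a - e) * G
    have hFI : F ∈ I := I.mul_mem_left _ (hS.span_eq ▸ Ideal.subset_span hG)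
    -- The scalar cancels the leading term of F, so only exponents strictly below a survive on the
    -- right.
    have hmk : Ideal.Quotient.mk I (monom a) =
        Ideal.Quotient.mk I (monom a - (coeff F a)⁻¹ • F) := by
      rw [Ideal.Quotient.eq, sub_sub_cancel, smul_eq_constHom_mul]
      exact I.mul_mem_left _ hFI
    rw [hmk]
    refine mk_mem_of_forall_mk_monom_mem hk fun b hb hne => ih b hb ?_
    rw [coeff_sub, coeff_smul, coeff_monom] at hne
    by_cases hba : b = a
    · subst hba
      exact absurd (by simp [inv_mul_cancel₀ hlead.1]) hne
    · exact hlead.2 b (fun h => by simp [hba, h] at hne) hba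
  · exact Submodule.subset_span ⟨⟨monom a, ⟨a, rfl⟩, hB⟩, rfl⟩

end SmoothGerms

end

theorem mainTheorem8 (r : ℕ × ℕ → ℕ × ℕ → Prop) (hr : SmoothGerms.IsLocalOrder r)
    (I : Ideal SmoothGerms.E) (hI : SmoothGerms.FiniteCodim I)
    (S : Set SmoothGerms.E) (hS : SmoothGerms.IsStandardBasis r S I) :
    ∃ b : Module.Basis (SmoothGerms.standardMonomials r S) ℝ (SmoothGerms.E ⧸ I),
      ∀ w : SmoothGerms.standardMonomials r S, b w = Ideal.Quotient.mk I (w : SmoothGerms.E) := by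
  obtain ⟨k, hk⟩ := hI
  refine ⟨Module.Basis.mk (SmoothGerms.linearIndependent_mk_standardMonomials hr hS) ?_,
    fun w => by rw [Module.Basis.mk_apply]⟩
  intro q _
  obtain ⟨F, rfl⟩ := Ideal.Quotient.mk_surjective q
  exact SmoothGerms.mk_mem_of_forall_mk_monom_mem hk fun a ha _ =>
    SmoothGerms.mk_monom_mem_span_standardMonomials hr hS hk ha
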